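/- For positive integers $m,n$ let $\mathbb{M}_{m\times n}(\mathbb{C})$ be the space of complex $m\times n$ matrices, let $\sigma_1(A)\ge\sigma_2(A)\ge\cdots\ge\sigma_{\min\{m,n\}}(A)\ge 0$ denote the singular values of $A$, and for $1\le p<\infty$ and $1\le k\le\min\{m,n\}$ let $\|A\|_{(p,k)}=\left(\sigma_1^p(A)+\cdots+\sigma_k^p(A)\right)^{1/p}$ be the Ky Fan $p$-$k$ norm. For a complex subspace $\mathcal{M}$ of $\mathbb{M}_{m\times n}(\mathbb{C})$ let $\mathcal{M}^\perp=\{G\in\mathbb{M}_{m\times n}(\mathbb{C}):\operatorname{tr}(B^*G)=0\text{ for all }B\in\mathcal{M}\}$. A density matrix is a positive semidefinite matrix with trace $1$. Theorem. Let $2\le p<\infty$ and $1\le k\le\min\{m,n\}$, let $A\in\mathbb{M}_{m\times n}(\mathbb{C})$, and let $\mathcal{M}$ be a (complex) subspace of $\mathbb{M}_{m\times n}(\mathbb{C})$. Suppose that $$\|A\|_{(p,k)}\le\|A+B\|_{(p,k)}\quad\text{for all }B\in\mathcal{M}.$$ Then there exist density matrices $T_1,\dots,T_k\in\mathbb{M}_{n\times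 n}(\mathbb{C})$ such that $A^*AT_i=\sigma_i^2(A)\,T_i$ for each $1\le i\le k$ and $$\frac{1}{\|A\|_{(p,k)}^{p-1}}\,A(A^*A)^{\frac{p-2}{2}}\sum_{i=1}^kT_i\in\mathcal{M}^\perp.$$ Here $(A^*A)^{0}$ is the identity matrix, and for $A=0$ the last matrix is read as the zero matrix. -/

import Mathlib

open scoped Matrix ComplexOrder

namespace KyFan

/-- The singular values of a complex `m × n` matrix in non-increasing order, indexed from `0`
(so `singularValue A i` is `σ_{i+1}(A)`): the singular values of `A` as a linear map between the
Euclidean spaces `ℂⁿ → ℂᵐ`. -/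
noncomputable def singularValue {m n : ℕ} (A : Matrix (Fin m) (Fin n) ℂ) (i : ℕ) : ℝ :=
  (Matrix.toEuclideanLin A).singularValues i

/-- The Ky Fan `p`-`k` norm `(σ₁(A)^p + ⋯ + σ_k(A)^p)^(1/p)`. -/
noncomputable def pkNorm (p : ℝ) (k : ℕ) {m n : ℕ} (A : Matrix (Fin m) (Fin n) ℂ) : ℝ :=
  (∑ i ∈ Finset.range k, singularValue A i ^ p) ^ (1 / p)

/-- The real power `H ^ r` of a positive semidefinite matrix, by functional calculus: apply
`x ↦ x ^ r` to the eigenvalues. For `r = 0` this is the identity matrix. -/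
noncomputable def matrixPow {n : ℕ} (H : Matrix (Fin n) (Fin n) ℂ) (r : ℝ) :
    Matrix (Fin n) (Fin n) ℂ :=
  cfc (fun x : ℝ => x ^ r) H

/-- A density matrix: positive semidefinite with trace one. -/
def IsDensityMatrix {n : ℕ} (T : Matrix (Fin n) (Fin n) ℂ) : Prop :=
  T.PosSemidef ∧ T.trace = 1

/-- The orthogonal complement of a complex subspace of matrices with respect to the trace inner
product `⟨B, G⟩ = tr(B* G)`. -/
def orthogonalComplement {m n : ℕ} (M : Submodule ℂ (Matrix (Fin m) (Fin n) ℂ)) :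
    Submodule ℂ (Matrix (Fin m) (Fin n) ℂ) where
  carrier := {G | ∀ B ∈ M, (Bᴴ * G).trace = 0}
  add_mem' := by
    intro G G' hG hG' B hB
    rw [Matrix.mul_add, Matrix.trace_add, hG B hB, hG' B hB, add_zero]
  zero_mem' := by
    intro B _
    simp
  smul_mem' := by
    intro c G hG B hB
    rw [Matrix.mul_smul, Matrix.trace_smul, hG B hB, smul_zero]

end KyFan

/-! ### Scalar inequalities -/

namespace KyFan

open Filter Topology Module

/-! With `q = p / 2`, the `p`-th power of the norm is the sum of the `k` largest `(σ²)^q`. If it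
does not decrease along the ray `A + tB`, a nonnegative one-sided derivative at `A` is attained by
some leading right singular vectors `v i`: `∑ σ_i^(p-2) Re⟨A v_i, B v_i⟩ ≥ 0`. They are found as
limits of singular vectors of `A + tB` as `t → 0` (`exists_singularVectors_of_forall_le`). With `T i
= v_i v_i*` this says `Re tr(B* G) ≥ 0`, where `G = A (A*A)^((p-2)/2) ∑ T i`.

These `T i` depend on `B`. Allowing density matrices instead of rank-one projections makes the set
of admissible tuples convex as well as compact, so the matrices `G` form a compact convex set. Such
a set meets `M⊥` as soon as each `B ∈ M` has some `G` in it with `Re tr(B* G) ≥ 0`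
(`exists_mem_orthogonalComplement`). -/

theorem rpow_sub_rpow_le_mul_sub {q a b : ℝ} (hq : 1 ≤ q) (ha : 0 ≤ a) (hb : 0 ≤ b) :
    a ^ q - b ^ q ≤ q * a ^ (q - 1) * (a - b) := by
  rcases ha.eq_or_lt with rfl | ha
  · rcases hq.eq_or_lt with rfl | hq
    · simp
    · rw [Real.zero_rpow (by linarith), Real.zero_rpow (by linarith)]
      have := Real.rpow_nonneg hb q
      linarith
  · have h := one_add_mul_self_le_rpow_one_add (s := b / a - 1)
      (by have := div_nonneg hb ha.le; linarith) hq
    rw [add_sub_cancel, Real.div_rpow hb ha.le, le_div_iff₀ (Real.rpow_pos_of_pos ha q)] at h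
    have h2 : a ^ q = a ^ (q - 1) * a := by
      rw [← Real.rpow_add_one ha.ne', sub_add_cancel]
    have h3 : (1 + q * (b / a - 1)) * a ^ q = a ^ q + q * a ^ (q - 1) * (b - a) := by
      rw [h2]; field_simp
    rw [h3] at h
    linarith

/-- A weighted sum of an antitone sequence, with weights in `[0, 1]` of total mass `k`, is at most
the sum of its first `k` terms. -/
theorem sum_mul_le_sum_range_of_antitone {n k : ℕ} (hk : k ≤ n) {s : ℕ → ℝ} (hs : Antitone s)
    {c : Fin n → ℝ} (hc0 : ∀ j, 0 ≤ c j) (hc1 : ∀ j, c j ≤ 1) (hc : ∑ j, c j = k) :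
    ∑ j : Fin n, s j * c j ≤ ∑ i ∈ Finset.range k, s i := by
  -- Recentring at the last kept term makes the summands with `j < k` nonnegative and the others
  -- nonpositive. The total mass `k` cancels the shift at the end.
  have h1 : ∑ j : Fin n, (s j - s (k - 1)) * c j ≤
      ∑ j : Fin n, if (j : ℕ) < k then s j - s (k - 1) else 0 := by
    refine Finset.sum_le_sum fun j _ => ?_
    split_ifs with hj
    · exact mul_le_of_le_one_right (sub_nonneg.2 (hs (by omega))) (hc1 j)
    · exact mul_nonpos_of_nonpos_of_nonneg (sub_nonpos.2 (hs (by omega))) (hc0 j)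
  have h2 : (∑ j : Fin n, if (j : ℕ) < k then s j - s (k - 1) else 0) =
      ∑ i ∈ Finset.range k, (s i - s (k - 1)) := by
    rw [Fin.sum_univ_eq_sum_range (fun i => if i < k then s i - s (k - 1) else 0) n,
      ← Finset.sum_filter]
    congr 1
    ext i
    simp only [Finset.mem_filter, Finset.mem_range]
    omega
  rw [h2] at h1
  simp only [sub_mul, Finset.sum_sub_distrib, ← Finset.mul_sum, hc, Finset.sum_const,
    Finset.card_range, nsmul_eq_mul] at h1
  linarith

/-! ### Singular values and one-sided derivatives -/

section LinearMap

variable {E F : Type*} [NormedAddCommGroup E] [InnerProductSpace ℂ E] [FiniteDimensional ℂ E]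
  [NormedAddCommGroup F] [InnerProductSpace ℂ F] [FiniteDimensional ℂ F]

theorem exists_rightSingularBasis (T : E →ₗ[ℂ] F) {n : ℕ} (hn : finrank ℂ E = n) :
    ∃ u : OrthonormalBasis (Fin n) ℂ E,
      ∀ i, T.adjoint (T (u i)) = ((T.singularValues i ^ 2 : ℝ) : ℂ) • u i := by
  refine ⟨T.isSymmetric_adjoint_comp_self.eigenvectorBasis hn, fun i => ?_⟩
  rw [T.sq_singularValues_fin hn i]
  exact T.isSymmetric_adjoint_comp_self.apply_eigenvectorBasis hn i

theorem norm_sq_apply_eigenvector {T : E →ₗ[ℂ] F} {x : E} {c : ℝ}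
    (h : T.adjoint (T x) = (c : ℂ) • x) : ‖T x‖ ^ 2 = c * ‖x‖ ^ 2 := by
  have h1 : inner ℂ (T x) (T x) = (c : ℂ) * inner ℂ x x := by
    rw [← LinearMap.adjoint_inner_right, h, inner_smul_right]
  rw [inner_self_eq_norm_sq_to_K, inner_self_eq_norm_sq_to_K] at h1
  apply Complex.ofReal_injective
  push_cast
  exact h1

theorem norm_sq_apply_eq_sum (T : E →ₗ[ℂ] F) {n : ℕ} {u : OrthonormalBasis (Fin n) ℂ E}
    {c : Fin n → ℝ} (hu : ∀ i, T.adjoint (T (u i)) = (c i : ℂ) • u i) (x : E) :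
    ‖T x‖ ^ 2 = ∑ j, c j * ‖inner ℂ (u j) x‖ ^ 2 := by
  have h1 : inner ℂ (T x) (T x) = ∑ j, (c j : ℂ) * (‖inner ℂ (u j) x‖ : ℂ) ^ 2 := by
    rw [← LinearMap.adjoint_inner_right, ← u.sum_inner_mul_inner x]
    refine Finset.sum_congr rfl fun j _ => ?_
    rw [LinearMap.adjoint_inner_right, ← LinearMap.adjoint_inner_left, hu, inner_smul_left,
      Complex.conj_ofReal, ← inner_conj_symm x (u j), mul_left_comm, Complex.conj_mul']
  rw [inner_self_eq_norm_sq_to_K] at h1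
  apply Complex.ofReal_injective
  push_cast
  exact h1

/-- Each `‖T (v i)‖ ^ 2` is an average of the squared singular values with weights `|⟨u_j, v_i⟩|²`,
so Jensen applies. Summed over `i`, the weight of each `j` is at most `1` by Bessel and the total is
`k` by Parseval. -/
theorem sum_norm_apply_rpow_le (T : E →ₗ[ℂ] F) {n k : ℕ} (hn : finrank ℂ E = n) (hk : k ≤ n)
    {v : Fin k → E} (hv : Orthonormal ℂ v) {q : ℝ} (hq : 1 ≤ q) :
    ∑ i, (‖T (v i)‖ ^ 2) ^ q ≤ ∑ i ∈ Finset.range k, (T.singularValues i ^ 2) ^ q := by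
  obtain ⟨u, hu⟩ := exists_rightSingularBasis T hn
  have h1 : ∀ i, (‖T (v i)‖ ^ 2) ^ q ≤
      ∑ j : Fin n, (T.singularValues j ^ 2) ^ q * ‖inner ℂ (u j) (v i)‖ ^ 2 := by
    intro i
    have h := Real.rpow_arith_mean_le_arith_mean_rpow Finset.univ
      (fun j => ‖inner ℂ (u j) (v i)‖ ^ 2) (fun j : Fin n => T.singularValues j ^ 2)
      (fun j _ => by positivity) (by rw [u.sum_sq_norm_inner_right, hv.1 i, one_pow])
      (fun j _ => by positivity) hq
    rw [norm_sq_apply_eq_sum T hu]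
    simpa only [mul_comm] using h
  refine (Finset.sum_le_sum fun i _ => h1 i).trans ?_
  rw [Finset.sum_comm]
  simp only [← Finset.mul_sum]
  refine sum_mul_le_sum_range_of_antitone (s := fun j => (T.singularValues j ^ 2) ^ q) hk ?_
    (fun j => Finset.sum_nonneg fun i _ => by positivity) (fun j => ?_) ?_
  · intro i j hij
    have := T.singularValues_nonneg j
    have := T.singularValues_antitone hij
    dsimp only
    gcongr
  · have := hv.sum_inner_products_le (u j) (s := Finset.univ)
    simpa only [norm_inner_symm (u j), u.orthonormal.1 j, one_pow] using this
  · rw [Finset.sum_comm]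
    simp [u.sum_sq_norm_inner_right, hv.1]

/-- Otherwise `v 0, …, v i` have eigenvalues exceeding those of all `u l` with `l ≥ i`, hence are
orthogonal to them: `i + 1` orthonormal vectors in the span of `i`. -/
theorem le_sq_singularValues_of_orthonormal (T : E →ₗ[ℂ] F) {n k : ℕ} (hn : finrank ℂ E = n)
    (hk : k ≤ n) {v : Fin k → E} (hv : Orthonormal ℂ v) {c : Fin k → ℝ} (hc : Antitone c)
    (h : ∀ i, T.adjoint (T (v i)) = (c i : ℂ) • v i) (i : Fin k) :
    c i ≤ T.singularValues i ^ 2 := by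
  by_contra! hlt
  obtain ⟨u, hu⟩ := exists_rightSingularBasis T hn
  have hz : ∀ j ≤ i, ∀ l : Fin n, (i : ℕ) ≤ l → inner ℂ (u l) (v j) = 0 := by
    intro j hj l hl
    have h1 : inner ℂ (u l) (T.adjoint (T (v j))) = inner ℂ (T.adjoint (T (u l))) (v j) := by
      rw [LinearMap.adjoint_inner_right, LinearMap.adjoint_inner_left]
    rw [h, hu, inner_smul_left, inner_smul_right, Complex.conj_ofReal] at h1
    have h2 : T.singularValues l ^ 2 < c j := by
      have := T.singularValues_nonneg l
      have h3 := T.singularValues_antitone hl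
      calc T.singularValues l ^ 2 ≤ T.singularValues i ^ 2 := by gcongr
        _ < c i := hlt
        _ ≤ c j := hc hj
    rcases mul_eq_mul_right_iff.1 h1 with h3 | h3
    · exact absurd (Complex.ofReal_injective h3) h2.ne'
    · exact h3
  -- The dimension count as a double sum: Parseval over `l` gives `i + 1`, while Bessel over `j`
  -- gives at most `i`.
  have h1 : ∑ j ∈ Finset.Iic i, ∑ l : Fin n, ‖inner ℂ (u l) (v j)‖ ^ 2 = (i : ℕ) + 1 := by
    simp [u.sum_sq_norm_inner_right, hv.1]
  have h2 : ∑ l : Fin n, ∑ j ∈ Finset.Iic i, ‖inner ℂ (u l) (v j)‖ ^ 2 ≤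
      ∑ l : Fin n, if (l : ℕ) < i then (1 : ℝ) else 0 := by
    refine Finset.sum_le_sum fun l _ => ?_
    split_ifs with hl
    · have := hv.sum_inner_products_le (u l) (s := Finset.Iic i)
      simpa only [norm_inner_symm (u l), u.orthonormal.1 l, one_pow] using this
    · refine (Finset.sum_eq_zero fun j hj => ?_).le
      rw [hz j (Finset.mem_Iic.1 hj) l (by omega)]
      simp
  have h3 : (∑ l : Fin n, if (l : ℕ) < i then (1 : ℝ) else 0) = i := by
    rw [Fin.sum_univ_eq_sum_range (fun l => if l < (i : ℕ) then (1 : ℝ) else 0) n,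
      ← Finset.sum_filter]
    have : (Finset.range n).filter (· < (i : ℕ)) = Finset.range i := by
      ext l
      simp only [Finset.mem_filter, Finset.mem_range]
      omega
    simp [this]
  rw [Finset.sum_comm, h1, h3] at h2
  linarith

/-- If the sum of the `q`-th powers of the `k` largest squared singular values does not decrease
from `T` in the direction `S`, then some orthonormal family of `k` leading right singular vectors
of `T` witnesses that its one-sided derivative is nonnegative. -/
theorem exists_singularVectors_of_forall_le (T S : E →ₗ[ℂ] F) {n k : ℕ} (hn : finrank ℂ E = n)
    (hk : k ≤ n) {q : ℝ} (hq : 1 ≤ q)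
    (hmin : ∀ t : ℝ, 0 < t → ∑ i ∈ Finset.range k, (T.singularValues i ^ 2) ^ q ≤
      ∑ i ∈ Finset.range k, ((T + (t : ℂ) • S).singularValues i ^ 2) ^ q) :
    ∃ v : Fin k → E, Orthonormal ℂ v ∧
      (∀ i, T.adjoint (T (v i)) = ((T.singularValues i ^ 2 : ℝ) : ℂ) • v i) ∧
      0 ≤ ∑ i : Fin k, (T.singularValues i ^ 2) ^ (q - 1) * (inner ℂ (T (v i)) (S (v i))).re := by
  have hw : ∀ R : E →ₗ[ℂ] F, ∃ w : Fin k → E, Orthonormal ℂ w ∧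
      ∀ i, R.adjoint (R (w i)) = ((R.singularValues i ^ 2 : ℝ) : ℂ) • w i := by
    intro R
    obtain ⟨u, hu⟩ := exists_rightSingularBasis R hn
    exact ⟨fun i => u (Fin.castLE hk i), u.orthonormal.comp _ (Fin.castLE_injective hk),
      fun i => hu (Fin.castLE hk i)⟩
  choose w hwo hwe using hw
  have hwn : ∀ R : E →ₗ[ℂ] F, ∀ i, ‖R (w R i)‖ ^ 2 = R.singularValues i ^ 2 := by
    intro R i
    rw [norm_sq_apply_eigenvector (hwe R i), (hwo R).1 i]
    simp
  have : ProperSpace E := FiniteDimensional.proper ℂ E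
  set R₀ : ℕ → E →ₗ[ℂ] F := fun j => T + ((1 / ((j : ℝ) + 1) : ℝ) : ℂ) • S with hR₀
  -- Tuples of unit vectors lie in the unit ball of the sup norm, so a subsequence of the perturbed
  -- singular families converges.
  obtain ⟨v, -, φ, hφ, hlim⟩ := (isCompact_closedBall (0 : Fin k → E) 1).tendsto_subseq
    (x := fun j => w (R₀ j)) (fun j => by
      rw [mem_closedBall_zero_iff, pi_norm_le_iff_of_nonneg zero_le_one]
      exact fun i => ((hwo _).1 i).le)
  set t : ℕ → ℝ := fun j => 1 / ((φ j : ℝ) + 1) with ht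
  set R : ℕ → E →ₗ[ℂ] F := fun j => T + (t j : ℂ) • S with hR
  set x : ℕ → Fin k → E := fun j => w (R j) with hx
  have htpos : ∀ j, 0 < t j := fun j => by positivity
  have htlim : Tendsto t atTop (𝓝 0) := tendsto_one_div_add_atTop_nhds_zero_nat.comp hφ.tendsto_atTop
  have htC : Tendsto (fun j => (t j : ℂ)) atTop (𝓝 0) := by
    simpa using! (Complex.continuous_ofReal.tendsto 0).comp htlim
  have hxlim : ∀ i, Tendsto (fun j => x j i) atTop (𝓝 (v i)) := fun i => tendsto_pi_nhds.1 hlim i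
  have hT : Continuous T := T.continuous_of_finiteDimensional
  have hS : Continuous S := S.continuous_of_finiteDimensional
  have hTx : ∀ i, Tendsto (fun j => T (x j i)) atTop (𝓝 (T (v i))) :=
    fun i => (hT.tendsto _).comp (hxlim i)
  have hSx : ∀ i, Tendsto (fun j => S (x j i)) atTop (𝓝 (S (v i))) :=
    fun i => (hS.tendsto _).comp (hxlim i)
  have hRx : ∀ i, Tendsto (fun j => R j (x j i)) atTop (𝓝 (T (v i))) := by
    intro i
    simpa [hR] using (hTx i).add (htC.smul (hSx i))
  have hsv : ∀ i : Fin k, Tendsto (fun j => (R j).singularValues i ^ 2) atTop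
      (𝓝 (‖T (v i)‖ ^ 2)) := by
    intro i
    simp only [← hwn]
    exact (hRx i).norm.pow 2
  have hvo : Orthonormal ℂ v := by
    rw [orthonormal_iff_ite]
    intro i j
    refine tendsto_nhds_unique ((hxlim i).inner (hxlim j)) ?_
    simp only [orthonormal_iff_ite.1 (hwo _) i j, hx]
    exact tendsto_const_nhds
  have hve : ∀ i, T.adjoint (T (v i)) = ((‖T (v i)‖ ^ 2 : ℝ) : ℂ) • v i := by
    intro i
    have hTa : Continuous T.adjoint := LinearMap.continuous_of_finiteDimensional _
    have hSa : Continuous S.adjoint := LinearMap.continuous_of_finiteDimensional _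
    have h1 : Tendsto (fun j => (R j).adjoint (R j (x j i))) atTop (𝓝 (T.adjoint (T (v i)))) := by
      have h2 : ∀ j, (R j).adjoint (R j (x j i)) =
          T.adjoint (R j (x j i)) + (t j : ℂ) • S.adjoint (R j (x j i)) := by
        intro j
        have h3 : (R j).adjoint = T.adjoint + (t j : ℂ) • S.adjoint := by
          simp only [hR]
          rw [map_add, map_smulₛₗ, Complex.conj_ofReal]
        rw [h3]
        rfl
      simp only [h2]
      simpa using ((hTa.tendsto _).comp (hRx i)).add (htC.smul ((hSa.tendsto _).comp (hRx i)))
    refine tendsto_nhds_unique h1 ?_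
    simp only [hx, hwe]
    exact ((Complex.continuous_ofReal.tendsto _).comp (hsv i)).smul (hxlim i)
  -- The limit vectors are eigenvectors of `T*T`, but not yet known to be leading ones. Their
  -- eigenvalues are termwise at most the leading ones, and `hmin` in the limit bounds the sum of
  -- `q`-th powers from below, forcing equality.
  have hle : ∀ i : Fin k, ‖T (v i)‖ ^ 2 ≤ T.singularValues i ^ 2 := by
    refine le_sq_singularValues_of_orthonormal T hn hk hvo (fun a b hab => ?_) hve
    refine le_of_tendsto_of_tendsto' (hsv b) (hsv a) fun j => ?_
    have := (R j).singularValues_nonneg b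
    have := (R j).singularValues_antitone (show (a : ℕ) ≤ b from hab)
    gcongr
  have hq0 : 0 < q := by linarith
  have hpow : ∀ i : Fin k, Tendsto (fun j => ((R j).singularValues i ^ 2) ^ q) atTop
      (𝓝 ((‖T (v i)‖ ^ 2) ^ q)) :=
    fun i => (hsv i).rpow_const (Or.inr hq0.le)
  have hge : ∑ i : Fin k, (T.singularValues i ^ 2) ^ q ≤ ∑ i : Fin k, (‖T (v i)‖ ^ 2) ^ q := by
    refine ge_of_tendsto' (tendsto_finsetSum _ fun i _ => hpow i) fun j => ?_
    rw [Fin.sum_univ_eq_sum_range (fun i => (T.singularValues i ^ 2) ^ q) k,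
      Fin.sum_univ_eq_sum_range (fun i => ((R j).singularValues i ^ 2) ^ q) k]
    exact hmin (t j) (htpos j)
  have heq : ∀ i : Fin k, ‖T (v i)‖ ^ 2 = T.singularValues i ^ 2 := by
    have h1 : ∀ i : Fin k, (‖T (v i)‖ ^ 2) ^ q ≤ (T.singularValues i ^ 2) ^ q :=
      fun i => Real.rpow_le_rpow (by positivity) (hle i) hq0.le
    have h2 := (Finset.sum_eq_sum_iff_of_le fun i _ => h1 i).1
      (le_antisymm (Finset.sum_le_sum fun i _ => h1 i) hge)
    intro i
    exact (Real.rpow_left_inj (by positivity) (by positivity) hq0.ne').1 (h2 i (Finset.mem_univ i))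
  refine ⟨v, hvo, fun i => by rw [hve, heq], ?_⟩
  -- Evaluating `T` on the singular vectors of `R j` gives at most the value at `T`, hence at most
  -- that at `R j`. The tangent inequality, based at the singular values of `R j`, bounds this gap
  -- by `t j` times the sum shown.
  have hd : ∀ j, 0 ≤ ∑ i : Fin k, q * ((R j).singularValues i ^ 2) ^ (q - 1) *
      (2 * (inner ℂ (T (x j i)) (S (x j i))).re + t j * ‖S (x j i)‖ ^ 2) := by
    intro j
    have h1 : ∑ i : Fin k, (‖T (x j i)‖ ^ 2) ^ q ≤ ∑ i : Fin k, ((R j).singularValues i ^ 2) ^ q := by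
      rw [Fin.sum_univ_eq_sum_range (fun i => ((R j).singularValues i ^ 2) ^ q) k]
      exact (sum_norm_apply_rpow_le T hn hk (hwo _) hq).trans (hmin (t j) (htpos j))
    have h2 : 0 ≤ ∑ i : Fin k, (((R j).singularValues i ^ 2) ^ q - (‖T (x j i)‖ ^ 2) ^ q) := by
      rw [Finset.sum_sub_distrib]
      linarith
    have h3 : 0 ≤ t j * ∑ i : Fin k, q * ((R j).singularValues i ^ 2) ^ (q - 1) *
        (2 * (inner ℂ (T (x j i)) (S (x j i))).re + t j * ‖S (x j i)‖ ^ 2) := by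
      refine h2.trans ?_
      rw [Finset.mul_sum]
      refine Finset.sum_le_sum fun i _ => ?_
      refine (rpow_sub_rpow_le_mul_sub hq (by positivity) (by positivity)).trans_eq ?_
      have h4 : (R j).singularValues i ^ 2 - ‖T (x j i)‖ ^ 2 =
          t j * (2 * (inner ℂ (T (x j i)) (S (x j i))).re + t j * ‖S (x j i)‖ ^ 2) := by
        rw [← hwn, hR]
        simp only [LinearMap.add_apply, LinearMap.smul_apply]
        rw [@norm_add_sq ℂ, inner_smul_right, norm_smul, Complex.norm_real, mul_pow,
          Real.norm_eq_abs, sq_abs]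
        simp only [RCLike.re_to_complex, Complex.re_ofReal_mul, hx, hR]
        ring
      rw [h4]
      ring
    exact (mul_nonneg_iff_of_pos_left (htpos j)).1 h3
  have hdl : Tendsto (fun j => ∑ i : Fin k, q * ((R j).singularValues i ^ 2) ^ (q - 1) *
      (2 * (inner ℂ (T (x j i)) (S (x j i))).re + t j * ‖S (x j i)‖ ^ 2)) atTop
      (𝓝 (∑ i : Fin k, q * (T.singularValues i ^ 2) ^ (q - 1) *
        (2 * (inner ℂ (T (v i)) (S (v i))).re + 0 * ‖S (v i)‖ ^ 2))) := by
    refine tendsto_finsetSum _ fun i _ => ?_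
    refine Tendsto.mul ?_ ?_
    -- Continuity of the power at a vanishing singular value needs `q - 1 ≥ 0`, that is, `p ≥ 2` in
    -- the application.
    · rw [← heq]
      exact ((hsv i).rpow_const (Or.inr (by linarith))).const_mul q
    · exact (((Complex.continuous_re.tendsto _).comp ((hTx i).inner (hSx i))).const_mul 2).add
        (htlim.mul ((hSx i).norm.pow 2))
  have h0 := ge_of_tendsto' hdl hd
  have h1 : ∑ i : Fin k, q * (T.singularValues i ^ 2) ^ (q - 1) *
        (2 * (inner ℂ (T (v i)) (S (v i))).re + 0 * ‖S (v i)‖ ^ 2) =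
      (2 * q) * ∑ i : Fin k, (T.singularValues i ^ 2) ^ (q - 1) *
        (inner ℂ (T (v i)) (S (v i))).re := by
    rw [Finset.mul_sum]
    exact Finset.sum_congr rfl fun i _ => by ring
  rw [h1] at h0
  exact (mul_nonneg_iff_of_pos_left (mul_pos two_pos hq0)).1 h0

end LinearMap

end KyFan

/-! ### Separation and density matrices -/

namespace KyFan

/-- Let `P g₀` be the point nearest `0` in the projection of `K` to `S`. The variational inequality
gives `‖P g₀‖² ≤ Re⟨P g₀, g⟩` on `K`, and the hypothesis at `b = -P g₀` forces `P g₀ = 0`. -/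
theorem exists_mem_orthogonal_of_forall_exists_re_inner_nonneg {H : Type*} [NormedAddCommGroup H]
    [InnerProductSpace ℂ H] (S : Submodule ℂ H) [S.HasOrthogonalProjection] {K : Set H}
    (hKc : IsCompact K) (hKv : Convex ℝ K) (hne : K.Nonempty)
    (h : ∀ b ∈ S, ∃ g ∈ K, 0 ≤ (inner ℂ b g).re) : ∃ g ∈ K, g ∈ Sᗮ := by
  let : InnerProductSpace ℝ H := InnerProductSpace.rclikeToReal ℂ H
  set P := S.starProjection with hP
  have hcv : Convex ℝ (P '' K) := hKv.linear_image (P.restrictScalars ℝ).toLinearMap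
  have hcc : IsCompact (P '' K) := hKc.image P.continuous
  obtain ⟨b, ⟨g₀, hg₀, rfl⟩, hb⟩ :=
    exists_norm_eq_iInf_of_complete_convex (hne.image P) hcc.isComplete hcv 0
  rw [norm_eq_iInf_iff_real_inner_le_zero hcv ⟨g₀, hg₀, rfl⟩] at hb
  have hmem : P g₀ ∈ S := S.starProjection_apply_mem g₀
  obtain ⟨g, hg, hgn⟩ := h (-P g₀) (S.neg_mem hmem)
  have h1 := hb (P g) ⟨g, hg, rfl⟩
  have h2 : inner ℂ (P g₀) (P g) = inner ℂ (P g₀) g := by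
    rw [← S.inner_starProjection_left_eq_right, S.starProjection_eq_self_iff.2 hmem]
  have h3 : ‖P g₀‖ ^ 2 ≤ (inner ℂ (P g₀) g).re := by
    rw [zero_sub, inner_neg_left, inner_sub_right, real_inner_self_eq_norm_sq,
      real_inner_eq_re_inner ℂ, h2] at h1
    simp only [RCLike.re_to_complex] at h1
    linarith
  rw [inner_neg_left, Complex.neg_re] at hgn
  have h4 : P g₀ = 0 := by
    have : ‖P g₀‖ ^ 2 ≤ 0 := by linarith
    simpa using this
  exact ⟨g₀, hg₀, (S.starProjection_apply_eq_zero_iff).1 h4⟩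

theorem exists_mem_orthogonalComplement {m n : ℕ}
    (M : Submodule ℂ (Matrix (Fin m) (Fin n) ℂ)) {K : Set (Matrix (Fin m) (Fin n) ℂ)}
    (hKc : IsCompact K) (hKv : Convex ℝ K) (hne : K.Nonempty)
    (h : ∀ B ∈ M, ∃ G ∈ K, 0 ≤ (Bᴴ * G).trace.re) : ∃ G ∈ K, G ∈ orthogonalComplement M := by
  let L : Matrix (Fin m) (Fin n) ℂ ≃ₗ[ℂ] EuclideanSpace ℂ (Fin m × Fin n) :=
    (LinearEquiv.curry ℂ ℂ (Fin m) (Fin n)).symm.trans (WithLp.linearEquiv 2 ℂ _).symm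
  have hL : ∀ B G, inner ℂ (L B) (L G) = (Bᴴ * G).trace := by
    intro B G
    simp only [PiLp.inner_apply, Matrix.trace, Matrix.diag_apply, Matrix.mul_apply,
      Matrix.conjTranspose_apply]
    rw [Fintype.sum_prod_type, Finset.sum_comm]
    refine Finset.sum_congr rfl fun j _ => Finset.sum_congr rfl fun i _ => ?_
    exact mul_comm _ _
  have hLc : Continuous L :=
    (PiLp.continuous_toLp 2 _).comp (continuous_pi fun ij => by
      exact (continuous_apply ij.2).comp (continuous_apply ij.1))
  obtain ⟨-, ⟨G, hG, rfl⟩, hGo⟩ := exists_mem_orthogonal_of_forall_exists_re_inner_nonneg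
    (M.map L.toLinearMap) (hKc.image hLc)
    (hKv.linear_image (L.toLinearMap.restrictScalars ℝ)) (hne.image L) (by
      rintro - ⟨B, hB, rfl⟩
      obtain ⟨G, hG, hBG⟩ := h B hB
      exact ⟨L G, ⟨G, hG, rfl⟩, (congrArg Complex.re (hL B G)).symm ▸ hBG⟩)
  refine ⟨G, hG, fun B hB => ?_⟩
  rw [← hL]
  exact (Submodule.mem_orthogonal _ _).1 hGo (L B) ⟨B, hB, rfl⟩

/-- The boundedness half of compactness. Writing `T = ∑ v_l v_l*`, the trace is `∑ ‖v_l‖² = 1`, and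
AM-GM bounds each entry. -/
theorem IsDensityMatrix.norm_apply_le_one {n : ℕ} {T : Matrix (Fin n) (Fin n) ℂ}
    (hT : IsDensityMatrix T) (i j : Fin n) : ‖T i j‖ ≤ 1 := by
  obtain ⟨r, v, hv⟩ := Matrix.posSemidef_iff_eq_sum_vecMulVec.1 hT.1
  have happ : ∀ i j, T i j = ∑ l, v l i * star (v l j) := by
    intro i j
    rw [hv, Matrix.sum_apply]
    rfl
  have htr : ∑ i, ∑ l, ‖v l i‖ ^ 2 = 1 := by
    have h := hT.2
    simp only [Matrix.trace, Matrix.diag_apply, happ, RCLike.star_def, Complex.mul_conj'] at h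
    exact_mod_cast h
  have hle : ∀ i, ∑ l, ‖v l i‖ ^ 2 ≤ 1 := fun i => htr ▸
    Finset.single_le_sum (f := fun i => ∑ l, ‖v l i‖ ^ 2)
      (fun i _ => Finset.sum_nonneg fun l _ => by positivity) (Finset.mem_univ i)
  rw [happ]
  calc ‖∑ l, v l i * star (v l j)‖ ≤ ∑ l, ‖v l i‖ * ‖v l j‖ :=
        (norm_sum_le _ _).trans_eq (by simp)
    _ ≤ ∑ l, (‖v l i‖ ^ 2 + ‖v l j‖ ^ 2) / 2 :=
        Finset.sum_le_sum fun l _ => by nlinarith [sq_nonneg (‖v l i‖ - ‖v l j‖)]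
    _ = (∑ l, ‖v l i‖ ^ 2 + ∑ l, ‖v l j‖ ^ 2) / 2 := by
        rw [← Finset.sum_div, Finset.sum_add_distrib]
    _ ≤ 1 := by linarith [hle i, hle j]

theorem isClosed_setOf_isDensityMatrix {n : ℕ} :
    IsClosed {T : Matrix (Fin n) (Fin n) ℂ | IsDensityMatrix T} := by
  have h : {T : Matrix (Fin n) (Fin n) ℂ | IsDensityMatrix T} =
      {T | Tᴴ = T} ∩ (⋂ x : Fin n → ℂ, {T | 0 ≤ star x ⬝ᵥ (T *ᵥ x)}) ∩ {T | T.trace = 1} := by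
    ext T
    simp [IsDensityMatrix, Matrix.posSemidef_iff_dotProduct_mulVec, Matrix.IsHermitian]
  rw [h]
  refine ((isClosed_eq (by fun_prop) continuous_id).inter (isClosed_iInter fun x => ?_)).inter
    (isClosed_eq (by fun_prop) continuous_const)
  exact isClosed_le continuous_const (by fun_prop)

theorem isCompact_setOf_isDensityMatrix {n : ℕ} :
    IsCompact {T : Matrix (Fin n) (Fin n) ℂ | IsDensityMatrix T} := by
  have h : IsCompact (Set.univ.pi fun _ : Fin n => Set.univ.pi fun _ : Fin n =>
      Metric.closedBall (0 : ℂ) 1) :=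
    isCompact_univ_pi fun _ => isCompact_univ_pi fun _ => isCompact_closedBall _ _
  refine IsCompact.of_isClosed_subset h isClosed_setOf_isDensityMatrix fun T hT i _ j _ => ?_
  simpa using hT.norm_apply_le_one i j

theorem convex_setOf_isDensityMatrix {n : ℕ} :
    Convex ℝ {T : Matrix (Fin n) (Fin n) ℂ | IsDensityMatrix T} := by
  intro T hT T' hT' a b ha hb hab
  refine ⟨(hT.1.smul ha).add (hT'.1.smul hb), ?_⟩
  rw [Matrix.trace_add, Matrix.trace_smul, Matrix.trace_smul, hT.2, hT'.2, ← add_smul, hab, one_smul]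

theorem isDensityMatrix_vecMulVec {n : ℕ} {x : EuclideanSpace ℂ (Fin n)} (hx : ‖x‖ = 1) :
    IsDensityMatrix (Matrix.vecMulVec x.ofLp (star x.ofLp)) := by
  refine ⟨Matrix.posSemidef_vecMulVec_self_star _, ?_⟩
  rw [Matrix.trace_vecMulVec, ← EuclideanSpace.inner_eq_star_dotProduct,
    inner_self_eq_norm_sq_to_K, hx]
  simp

theorem cfc_mul_of_mul_eq_smul {n : ℕ} {H T : Matrix (Fin n) (Fin n) ℂ} (hH : H.IsHermitian)
    {c : ℝ} (h : H * T = c • T) (f : ℝ → ℝ) : cfc f H * T = f c • T := by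
  classical
  have hfin : (spectrum ℝ H).Finite := Matrix.finite_real_spectrum
  -- On the finite spectrum `f` agrees with an interpolating polynomial. The node `c` is added
  -- because it need not be an eigenvalue when `T = 0`.
  set s : Finset ℝ := insert c hfin.toFinset with hs
  set q := Lagrange.interpolate s id f with hq
  have hqe : ∀ x ∈ s, q.eval x = f x := fun x hx =>
    Lagrange.eval_interpolate_at_node (v := id) f Function.injective_id.injOn hx
  have h1 : cfc f H = Polynomial.aeval H q := by
    rw [← cfc_polynomial q H hH]
    refine cfc_congr fun x hx => (hqe x ?_).symm
    simp [hs, hx]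
  have h2 : ∀ r : Polynomial ℝ, Polynomial.aeval H r * T = r.eval c • T := by
    intro r
    induction r using Polynomial.induction_on' with
    | add r r' hr hr' => rw [map_add, add_mul, hr, hr', Polynomial.eval_add, add_smul]
    | monomial d a =>
      have : H ^ d * T = c ^ d • T := by
        induction d with
        | zero => simp
        | succ d ih => rw [pow_succ, mul_assoc, h, Matrix.mul_smul, ih, smul_smul, pow_succ, mul_comm]
      rw [Polynomial.aeval_monomial, mul_assoc, this, Polynomial.eval_monomial,
        ← Algebra.smul_def, smul_smul]
  rw [h1, h2, hqe c (by simp [hs])]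

end KyFan

/-! ### Translation to matrices and conclusion -/

namespace KyFan

theorem sum_sq_singularValue_rpow_le_of_pkNorm_le {m n k : ℕ} {p : ℝ} (hp : 0 < p)
    {A B : Matrix (Fin m) (Fin n) ℂ} (h : pkNorm p k A ≤ pkNorm p k B) :
    ∑ i ∈ Finset.range k, (singularValue A i ^ 2) ^ (p / 2) ≤
      ∑ i ∈ Finset.range k, (singularValue B i ^ 2) ^ (p / 2) := by
  have hnn : ∀ (C : Matrix (Fin m) (Fin n) ℂ) i, 0 ≤ singularValue C i :=
    fun C i => LinearMap.singularValues_nonneg _ i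
  have hpow : ∀ (C : Matrix (Fin m) (Fin n) ℂ) i,
      (singularValue C i ^ 2) ^ (p / 2) = singularValue C i ^ p := by
    intro C i
    rw [← Real.rpow_natCast, ← Real.rpow_mul (hnn C i)]
    congr 1
    push_cast
    ring
  simp only [hpow]
  have hs : ∀ C : Matrix (Fin m) (Fin n) ℂ, 0 ≤ ∑ i ∈ Finset.range k, singularValue C i ^ p :=
    fun C => Finset.sum_nonneg fun i _ => Real.rpow_nonneg (hnn C i) p
  exact (Real.rpow_le_rpow_iff (hs A) (hs B) (by positivity)).1 h

theorem adjoint_toEuclideanLin_apply {m n : ℕ} (A : Matrix (Fin m) (Fin n) ℂ)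
    (x : EuclideanSpace ℂ (Fin n)) :
    (A.toEuclideanLin.adjoint (A.toEuclideanLin x)).ofLp = (Aᴴ * A) *ᵥ x.ofLp := by
  rw [← Matrix.toEuclideanLin_conjTranspose_eq_adjoint, ← Matrix.mulVec_mulVec]
  rfl

theorem trace_conjTranspose_mul_mul_vecMulVec {m n : ℕ} (A B : Matrix (Fin m) (Fin n) ℂ)
    (x : EuclideanSpace ℂ (Fin n)) :
    (Bᴴ * (A * Matrix.vecMulVec x.ofLp (star x.ofLp))).trace =
      inner ℂ (B.toEuclideanLin x) (A.toEuclideanLin x) := by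
  rw [Matrix.mul_vecMulVec, Matrix.mul_vecMulVec, Matrix.trace_vecMulVec,
    ← LinearMap.adjoint_inner_right, EuclideanSpace.inner_eq_star_dotProduct,
    ← Matrix.toEuclideanLin_conjTranspose_eq_adjoint]
  rfl

/-- The derivative condition for a single direction `B`, with `T i` the projection onto `v i`. On it
`(A*A)^((p-2)/2)` acts as the scalar `(σ²)^(p/2 - 1)`, the weight in the derivative. -/
theorem exists_isDensityMatrix_re_trace_nonneg {m n k : ℕ} {p : ℝ} (hp : 2 ≤ p) (hk : k ≤ n)
    {A B : Matrix (Fin m) (Fin n) ℂ}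
    (hmin : ∀ t : ℝ, 0 < t → pkNorm p k A ≤ pkNorm p k (A + (t : ℂ) • B)) :
    ∃ T : Fin k → Matrix (Fin n) (Fin n) ℂ, (∀ i, IsDensityMatrix (T i)) ∧
      (∀ i, Aᴴ * A * T i = (singularValue A i ^ 2) • T i) ∧
      0 ≤ (Bᴴ * (A * matrixPow (Aᴴ * A) ((p - 2) / 2) * ∑ i, T i)).trace.re := by
  obtain ⟨v, hvo, hve, hvd⟩ := exists_singularVectors_of_forall_le A.toEuclideanLin
    B.toEuclideanLin finrank_euclideanSpace_fin hk (q := p / 2) (by linarith) (fun t ht => by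
      have h := sum_sq_singularValue_rpow_le_of_pkNorm_le (by linarith) (hmin t ht)
      simpa only [singularValue, map_add, map_smul] using h)
  have heig : ∀ i, Aᴴ * A * Matrix.vecMulVec (v i).ofLp (star (v i).ofLp) =
      (singularValue A i ^ 2) • Matrix.vecMulVec (v i).ofLp (star (v i).ofLp) := by
    intro i
    rw [Matrix.mul_vecMulVec, ← adjoint_toEuclideanLin_apply, hve i, WithLp.ofLp_smul,
      Matrix.smul_vecMulVec, Complex.coe_smul]
    rfl
  refine ⟨fun i => Matrix.vecMulVec (v i).ofLp (star (v i).ofLp),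
    fun i => isDensityMatrix_vecMulVec (hvo.1 i), heig, hvd.trans_eq ?_⟩
  rw [Matrix.mul_assoc, Matrix.mul_sum, Matrix.mul_sum, Matrix.mul_sum, Matrix.trace_sum,
    Complex.re_sum]
  refine Finset.sum_congr rfl fun i _ => ?_
  rw [matrixPow, cfc_mul_of_mul_eq_smul (Matrix.isHermitian_conjTranspose_mul_self A) (heig i),
    Matrix.mul_smul, Matrix.mul_smul, Matrix.trace_smul, trace_conjTranspose_mul_mul_vecMulVec,
    Complex.smul_re, ← inner_conj_symm, Complex.conj_re, smul_eq_mul,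
    show (p - 2) / 2 = p / 2 - 1 by ring]
  rfl

end KyFan

theorem mainTheorem8 (m n k : ℕ) (p : ℝ) (hp : 2 ≤ p) (hk : 1 ≤ k) (hkn : k ≤ min m n)
    (A : Matrix (Fin m) (Fin n) ℂ) (M : Submodule ℂ (Matrix (Fin m) (Fin n) ℂ))
    (hA : ∀ B ∈ M, KyFan.pkNorm p k A ≤ KyFan.pkNorm p k (A + B)) :
    ∃ T : Fin k → Matrix (Fin n) (Fin n) ℂ,
      (∀ i, KyFan.IsDensityMatrix (T i)) ∧
      (∀ i, Aᴴ * A * T i = (KyFan.singularValue A i ^ 2) • T i) ∧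
      (1 / KyFan.pkNorm p k A ^ (p - 1)) •
          (A * KyFan.matrixPow (Aᴴ * A) ((p - 2) / 2) * ∑ i, T i) ∈
        KyFan.orthogonalComplement M := by
  set C := A * KyFan.matrixPow (Aᴴ * A) ((p - 2) / 2) with hC
  -- The eigenvalue equations are linear in `T`, so they preserve both compactness and convexity.
  let 𝒟 : Set (Fin k → Matrix (Fin n) (Fin n) ℂ) :=
    (Set.univ.pi fun _ => {T | KyFan.IsDensityMatrix T}) ∩
      {T | ∀ i, Aᴴ * A * T i = (KyFan.singularValue A i ^ 2) • T i}
  have h𝒟c : IsCompact 𝒟 := by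
    refine (isCompact_univ_pi fun _ => KyFan.isCompact_setOf_isDensityMatrix).inter_right ?_
    simp only [Set.ofPred_forall]
    exact isClosed_iInter fun i => isClosed_eq (by fun_prop) (by fun_prop)
  have h𝒟v : Convex ℝ 𝒟 := by
    refine (convex_pi fun _ _ => KyFan.convex_setOf_isDensityMatrix).inter ?_
    intro T hT T' hT' a b _ _ _ i
    simp only [Pi.add_apply, Pi.smul_apply, Matrix.mul_add, Matrix.mul_smul, hT i, hT' i, smul_add]
    rw [smul_comm a, smul_comm b]
  let Φ : (Fin k → Matrix (Fin n) (Fin n) ℂ) →ₗ[ℝ] Matrix (Fin m) (Fin n) ℂ :=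
    { toFun := fun T => C * ∑ i, T i
      map_add' := fun T T' => by simp [Finset.sum_add_distrib, Matrix.mul_add]
      map_smul' := fun a T => by simp [← Finset.smul_sum] }
  have hΦ : Continuous Φ := by
    change Continuous fun T : Fin k → Matrix (Fin n) (Fin n) ℂ => C * ∑ i, T i
    fun_prop
  have hex : ∀ B ∈ M, ∃ T ∈ 𝒟, 0 ≤ (Bᴴ * Φ T).trace.re := by
    intro B hB
    obtain ⟨T, hT, hTe, hTr⟩ := KyFan.exists_isDensityMatrix_re_trace_nonneg hp
      (hkn.trans (min_le_right m n)) fun t _ => hA ((t : ℂ) • B) (M.smul_mem _ hB)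
    exact ⟨T, ⟨fun i _ => hT i, hTe⟩, hTr⟩
  obtain ⟨-, ⟨T, ⟨hT, hTe⟩, rfl⟩, hTo⟩ := KyFan.exists_mem_orthogonalComplement M
    (h𝒟c.image hΦ) (h𝒟v.linear_image Φ)
    (let ⟨T, hT, _⟩ := hex 0 M.zero_mem; ⟨Φ T, T, hT, rfl⟩)
    (fun B hB => let ⟨T, hT, hTr⟩ := hex B hB; ⟨Φ T, ⟨T, hT, rfl⟩, hTr⟩)
  -- The normalising factor is harmless because `M⊥` is a subspace. For `A = 0` it is `1 / 0 = 0`,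
  -- matching the convention in the statement.
  exact ⟨T, fun i => hT i trivial, hTe, Submodule.smul_of_tower_mem _ _ hTo⟩
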